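/- Let $d\ge 2$ and $I^d=(0,1)^d$. For $\alpha>0$ and $n\ge 1$ let $\mathcal A(\alpha,n)$ be the class of all sets $\Sigma=\overline{I^d}\cap\bigcup_{i=1}^n \overline{B(x_i,r)}$ with $r=\alpha n^{-1/d}$ and centres $x_i$ in the $r$-neighbourhood of $I^d$. For such a $\Sigma$ let $u_\Sigma\in H^1_0(I^d\setminus\Sigma)$ be the weak solution of $-\Delta u=1$ in $I^d\setminus\Sigma$, $u=0$ on $\Sigma\cup\partial I^d$, that is, $$\int_{I^d}\nabla u_\Sigma\cdot\nabla\varphi\,dx=\int_{I^d}\varphi\,dx\quad\text{for all }\varphi\in H^1_0(I^d\setminus\Sigma),$$ and let $F(\Sigma)=\int_{I^d}u_\Sigma\,dx$. Define $$\theta(\alpha)=\inf\Big\{\liminf_{n\to\infty} n^{2/d}F(\Sigma_n)\ :\ \Sigma_n\in\mathcal A(\alpha,n)\text{ for all }n\ge1\Big\}.$$ Then there is a constant $C=C(d)$ such that for every $\alpha>0$ $$\theta(\alpha)\le C\,\alpha^{2-d}\quad\text{if }d\ge 3,\qquad \theta(\alpha)\le C\,\max\Big\{0,\ \log\frac{1}{\sqrt2\,\alpha}\Big\}\quad\text{if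 }d=2.$$ -/

import Mathlib

open MeasureTheory Filter Topology
open scoped ContDiff ENNReal

noncomputable section

namespace OptimalCompliance

/-- `MemH10 U u g`: the function `u`, extended by zero outside the open set `U`, belongs to
`H₀¹(U)`, and `g` is its weak gradient. That is, `(u, g)` is the limit in `L² × L²` of pairs
`(φ, ∇φ)` with `φ` smooth and compactly supported in `U`. For a given `u`, the field `g` is
unique up to null sets, and both `u` and `g` vanish almost everywhere outside `U`. -/
def MemH10 {d : ℕ} (U : Set (EuclideanSpace ℝ (Fin d))) (u : EuclideanSpace ℝ (Fin d) → ℝ)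
    (g : EuclideanSpace ℝ (Fin d) → EuclideanSpace ℝ (Fin d)) : Prop :=
  MemLp u 2 volume ∧ MemLp g 2 volume ∧
    ∃ φ : ℕ → EuclideanSpace ℝ (Fin d) → ℝ,
      (∀ k, ContDiff ℝ ∞ (φ k) ∧ HasCompactSupport (φ k) ∧ tsupport (φ k) ⊆ U) ∧
      Tendsto (fun k => eLpNorm (fun x => φ k x - u x) 2 volume) atTop (𝓝 0) ∧
      Tendsto (fun k => eLpNorm (fun x => gradient (φ k) x - g x) 2 volume) atTop (𝓝 0)

/-- `u` is the weak solution `u_{f,S,Ω}` of `-Δu = f` in `Ω \ S`, `u = 0` on `S ∪ ∂Ω`: it lies in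
`H₀¹(Ω \ S)` and `∫_Ω ∇u · ∇φ = ∫_Ω f φ` for every `φ ∈ H₀¹(Ω \ S)`. -/
def IsWeakSolution {d : ℕ} (f : EuclideanSpace ℝ (Fin d) → ℝ)
    (S Ω : Set (EuclideanSpace ℝ (Fin d))) (u : EuclideanSpace ℝ (Fin d) → ℝ) : Prop :=
  ∃ g : EuclideanSpace ℝ (Fin d) → EuclideanSpace ℝ (Fin d), MemH10 (Ω \ S) u g ∧
    ∀ (φ : EuclideanSpace ℝ (Fin d) → ℝ)
      (ψ : EuclideanSpace ℝ (Fin d) → EuclideanSpace ℝ (Fin d)),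
      MemH10 (Ω \ S) φ ψ → ∫ x in Ω, inner ℝ (g x) (ψ x) = ∫ x in Ω, f x * φ x

/-- The compliance `F(S, f, Ω) = ∫_Ω f u`, where `u` is the weak solution `u_{f,S,Ω}`. The
solution is unique up to null sets, so that the infimum runs over a single value; the value
would be `⊤` only if there were no solution. -/
def compliance {d : ℕ} (S : Set (EuclideanSpace ℝ (Fin d))) (f : EuclideanSpace ℝ (Fin d) → ℝ)
    (Ω : Set (EuclideanSpace ℝ (Fin d))) : EReal :=
  ⨅ (u : EuclideanSpace ℝ (Fin d) → ℝ) (_ : IsWeakSolution f S Ω u),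
    ((∫ x in Ω, f x * u x : ℝ) : EReal)

/-- The radius `α n^{-1/d}`. -/
def radius (d : ℕ) (α : ℝ) (n : ℕ) : ℝ := α * (n : ℝ) ^ (-1 / (d : ℝ))

/-- The class `𝒜(α, n)(Ω)`: the traces on the closure of `Ω` of unions of `n` closed balls of
radius `r = α n^{-1/d}` with centres in the `r`-neighbourhood of `Ω`. -/
def admissible {d : ℕ} (α : ℝ) (n : ℕ) (Ω : Set (EuclideanSpace ℝ (Fin d))) :
    Set (Set (EuclideanSpace ℝ (Fin d))) :=
  {S | ∃ x : Fin n → EuclideanSpace ℝ (Fin d),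
    (∀ i, x i ∈ Metric.thickening (radius d α n) Ω) ∧
    S = closure Ω ∩ ⋃ i, Metric.closedBall (x i) (radius d α n)}

/-- The open unit cube `(0,1)^d`. -/
def unitCube (d : ℕ) : Set (EuclideanSpace ℝ (Fin d)) :=
  {x | ∀ i, x i ∈ Set.Ioo (0 : ℝ) 1}

/-- `θ(α) = inf { liminf_n n^{2/d} F(S_n, 1, (0,1)^d) : S_n ∈ 𝒜(α, n)((0,1)^d) }`, with values in
the extended reals. -/
def theta (d : ℕ) (α : ℝ) : EReal :=
  sInf {L : EReal | ∃ S : ℕ → Set (EuclideanSpace ℝ (Fin d)),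
    (∀ n : ℕ, 0 < n → S n ∈ admissible α n (unitCube d)) ∧
    L = liminf (fun n : ℕ => (((n : ℝ) ^ (2 / (d : ℝ)) : ℝ) : EReal) *
      compliance (S n) (fun _ => 1) (unitCube d)) atTop}

end OptimalCompliance

end

/-! The bound comes from one explicit competitor: for `n = m ^ d`, balls of radius `α / m` at the
centres of the `m ^ d` cubic cells of side `1 / m`. Since `theta` involves a liminf, it suffices to
control these `n`; the other terms only need some admissible set.

The compliance is a squared dual norm. If `|∫ φ| ≤ K ‖∇φ‖₂` for all test functions, then testing the
equation with its own solution gives `F = ‖∇u‖² ≤ K ‖∇u‖`, so `F ≤ K²` (`compliance_le`; existence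
is Lax–Milgram, from a Poincaré inequality on the cube). Hence only an inequality between mean and
energy is needed.

That inequality is proved cell by cell (`setLIntegral_enorm_le_of_starConvex`). Inside a cell, `φ`
vanishes on the ball of radius `r` about the centre, and integrating `∇φ` along rays from the centre
bounds `∫ |φ|` by `∫ |∇φ| w`, with `w(y) = (ρ^d / d) |y|^(1-d)` and `ρ` the circumradius. Only `r ≤
|y| ≤ ρ` contributes. Cauchy–Schwarz and polar coordinates produce a multiple of `∫_r^ρ s^(1-d) ds`,
which is of order `r^(2-d)` for `d ≥ 3` and equals a logarithm for `d = 2`.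

Summing over cells gives `K² = m ^ d * cellConst`. With `r` and `ρ` proportional to `1 / m`,
`cellConst` scales like `m ^ (-d - 2)`, so the factor `n ^ (2 / d) = m ^ 2` makes the bound
independent of `m`. -/

namespace OptimalCompliance

/-! ### The space `H₀¹` as a closed subspace, Lax–Milgram, and the dual bound of the compliance. -/

section WeakFormulation

variable {d : ℕ}

/-- Smooth functions with compact support in `U`. -/
def IsTest (U : Set (EuclideanSpace ℝ (Fin d))) (φ : EuclideanSpace ℝ (Fin d) → ℝ) : Prop :=
  ContDiff ℝ ∞ φ ∧ HasCompactSupport φ ∧ tsupport φ ⊆ U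

theorem gradient_eq_toDual_symm (φ : EuclideanSpace ℝ (Fin d) → ℝ) :
    gradient φ = fun x => (InnerProductSpace.toDual ℝ _).symm (fderiv ℝ φ x) := rfl

theorem enorm_gradient (φ : EuclideanSpace ℝ (Fin d) → ℝ) (x : EuclideanSpace ℝ (Fin d)) :
    ‖gradient φ x‖ₑ = ‖fderiv ℝ φ x‖ₑ := by
  rw [gradient_eq_toDual_symm, ← ofReal_norm, ← ofReal_norm, LinearIsometryEquiv.norm_map]

namespace IsTest

variable {U : Set (EuclideanSpace ℝ (Fin d))} {φ ψ : EuclideanSpace ℝ (Fin d) → ℝ}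

theorem contDiff_one (h : IsTest U φ) : ContDiff ℝ 1 φ := h.1.of_le (by simp)

theorem differentiable (h : IsTest U φ) : Differentiable ℝ φ :=
  h.contDiff_one.differentiable (by simp)

theorem eq_zero (h : IsTest U φ) {x : EuclideanSpace ℝ (Fin d)} (hx : x ∉ U) : φ x = 0 :=
  image_eq_zero_of_notMem_tsupport fun hx' => hx (h.2.2 hx')

theorem gradient_eq_zero (h : IsTest U φ) {x : EuclideanSpace ℝ (Fin d)} (hx : x ∉ U) :
    gradient φ x = 0 := by
  have : fderiv ℝ φ x = 0 := image_eq_zero_of_notMem_tsupport fun hx' =>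
    hx (h.2.2 (tsupport_fderiv_subset ℝ hx'))
  rw [gradient_eq_toDual_symm]
  simp [this]

theorem memLp (h : IsTest U φ) : MemLp φ 2 volume :=
  h.1.continuous.memLp_of_hasCompactSupport h.2.1

theorem continuous_gradient (h : IsTest U φ) : Continuous (gradient φ) :=
  (LinearIsometryEquiv.continuous _).comp (h.contDiff_one.continuous_fderiv (by simp))

theorem memLp_gradient (h : IsTest U φ) : MemLp (gradient φ) 2 volume :=
  h.continuous_gradient.memLp_of_hasCompactSupport
    ((h.2.1.fderiv ℝ).comp_left (map_zero (InnerProductSpace.toDual ℝ _).symm))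

theorem zero : IsTest U (0 : EuclideanSpace ℝ (Fin d) → ℝ) :=
  ⟨contDiff_const, HasCompactSupport.zero, by simp [tsupport]⟩

theorem add (h : IsTest U φ) (h' : IsTest U ψ) : IsTest U (φ + ψ) :=
  ⟨h.1.add h'.1, h.2.1.add h'.2.1,
    (tsupport_add φ ψ).trans (Set.union_subset h.2.2 h'.2.2)⟩

theorem smul (c : ℝ) (h : IsTest U φ) : IsTest U (c • φ) :=
  ⟨h.1.const_smul c, h.2.1.smul_left (f := fun _ => c),
    (tsupport_smul_subset_right (fun _ => c) φ).trans h.2.2⟩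

theorem gradient_add (h : IsTest U φ) (h' : IsTest U ψ) :
    gradient (φ + ψ) = gradient φ + gradient ψ := by
  ext1 x
  simp only [gradient_eq_toDual_symm, Pi.add_apply]
  rw [fderiv_add (h.differentiable x) (h'.differentiable x), map_add]

theorem gradient_smul (c : ℝ) (h : IsTest U φ) : gradient (c • φ) = c • gradient φ := by
  ext1 x
  simp only [gradient_eq_toDual_symm, Pi.smul_apply]
  rw [fderiv_const_smul (h.differentiable x) c]
  simp

end IsTest

/-- The Hilbert space of pairs of a square integrable function and a square integrable field. -/
abbrev PairSpace (d : ℕ) : Type :=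
  WithLp 2 (Lp ℝ 2 (volume : Measure (EuclideanSpace ℝ (Fin d))) ×
    Lp (EuclideanSpace ℝ (Fin d)) 2 (volume : Measure (EuclideanSpace ℝ (Fin d))))

/-- The pairs `(φ, ∇φ)` with `φ` smooth and compactly supported in `U`. -/
def testPairs (U : Set (EuclideanSpace ℝ (Fin d))) : Submodule ℝ (PairSpace d) where
  carrier := {p | ∃ φ, IsTest U φ ∧ p.fst =ᵐ[volume] φ ∧ p.snd =ᵐ[volume] gradient φ}
  zero_mem' := by
    refine ⟨0, .zero, Lp.coeFn_zero _ _ _, ?_⟩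
    have : gradient (0 : EuclideanSpace ℝ (Fin d) → ℝ) = 0 := by
      rw [gradient_eq_toDual_symm]; ext1 x; simp
    rw [this]
    exact Lp.coeFn_zero _ _ _
  add_mem' := by
    rintro p q ⟨φ, hφ, h1, h2⟩ ⟨ψ, hψ, h3, h4⟩
    refine ⟨φ + ψ, hφ.add hψ, (Lp.coeFn_add _ _).trans (h1.add h3), ?_⟩
    rw [hφ.gradient_add hψ]
    exact (Lp.coeFn_add _ _).trans (h2.add h4)
  smul_mem' := by
    rintro c p ⟨φ, hφ, h1, h2⟩
    refine ⟨c • φ, hφ.smul c, (Lp.coeFn_smul _ _).trans (h1.const_smul c), ?_⟩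
    rw [hφ.gradient_smul c]
    exact (Lp.coeFn_smul _ _).trans (h2.const_smul c)

/-- With its converse below, this identifies the sequential definition `MemH10` with a closed
subspace of a Hilbert space, where Lax–Milgram applies. -/
theorem memH10_of_mem_closure {U : Set (EuclideanSpace ℝ (Fin d))} {p : PairSpace d}
    (hp : p ∈ (testPairs U).topologicalClosure) : MemH10 U p.fst p.snd := by
  obtain ⟨q, hq, hlim⟩ := mem_closure_iff_seq_limit.1 hp
  choose φ hφ h1 h2 using hq
  have hfst : Tendsto (fun k => (q k).fst) atTop (𝓝 p.fst) :=
    ((continuous_fst.comp (WithLp.prod_continuous_ofLp 2 _ _)).tendsto p).comp hlim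
  have hsnd : Tendsto (fun k => (q k).snd) atTop (𝓝 p.snd) :=
    ((continuous_snd.comp (WithLp.prod_continuous_ofLp 2 _ _)).tendsto p).comp hlim
  refine ⟨Lp.memLp _, Lp.memLp _, φ, hφ, ?_, ?_⟩
  · refine ((Lp.tendsto_Lp_iff_tendsto_eLpNorm' _ _).1 hfst).congr fun k => eLpNorm_congr_ae ?_
    filter_upwards [h1 k] with x hx
    simp [hx]
  · refine ((Lp.tendsto_Lp_iff_tendsto_eLpNorm' _ _).1 hsnd).congr fun k => eLpNorm_congr_ae ?_
    filter_upwards [h2 k] with x hx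
    simp [hx]

theorem exists_mem_closure_of_memH10 {U : Set (EuclideanSpace ℝ (Fin d))}
    {u : EuclideanSpace ℝ (Fin d) → ℝ} {g : EuclideanSpace ℝ (Fin d) → EuclideanSpace ℝ (Fin d)}
    (h : MemH10 U u g) : ∃ p ∈ (testPairs U).topologicalClosure,
      p.fst =ᵐ[volume] u ∧ p.snd =ᵐ[volume] g := by
  obtain ⟨hu, hg, φ, hφ, h1, h2⟩ := h
  have hφ' : ∀ k, IsTest U (φ k) := hφ
  refine ⟨WithLp.toLp 2 (hu.toLp u, hg.toLp g), ?_, hu.coeFn_toLp, hg.coeFn_toLp⟩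
  refine mem_closure_iff_seq_limit.2 ⟨fun k => WithLp.toLp 2
    ((hφ' k).memLp.toLp _, (hφ' k).memLp_gradient.toLp _),
    fun k => ⟨φ k, hφ' k, (hφ' k).memLp.coeFn_toLp, (hφ' k).memLp_gradient.coeFn_toLp⟩, ?_⟩
  refine ((WithLp.prod_continuous_toLp 2 _ _).tendsto _).comp (Tendsto.prodMk_nhds ?_ ?_)
  · exact (Lp.tendsto_Lp_iff_tendsto_eLpNorm'' _ (fun k => (hφ' k).memLp) _ hu).2 h1
  · exact (Lp.tendsto_Lp_iff_tendsto_eLpNorm'' _ (fun k => (hφ' k).memLp_gradient) _ hg).2 h2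

/-- The weak gradient of a function in `H₀¹(U)` vanishes almost everywhere outside `U`. -/
theorem MemH10.ae_eq_zero_of_notMem {U Ω : Set (EuclideanSpace ℝ (Fin d))} (hΩ : MeasurableSet Ω)
    (hU : U ⊆ Ω) {u : EuclideanSpace ℝ (Fin d) → ℝ}
    {g : EuclideanSpace ℝ (Fin d) → EuclideanSpace ℝ (Fin d)} (h : MemH10 U u g) :
    ∀ᵐ x, x ∉ Ω → g x = 0 := by
  obtain ⟨-, hg, φ, hφ, -, h2⟩ := h
  have hφ' : ∀ k, IsTest U (φ k) := hφ
  -- Test gradients vanish off `Ω`, so there the approximation error is exactly `-g`.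
  have hle : ∀ k, eLpNorm g 2 (volume.restrict Ωᶜ) ≤
      eLpNorm (fun x => gradient (φ k) x - g x) 2 volume := fun k => by
    refine le_trans (le_of_eq ?_) (eLpNorm_mono_measure _
      (Measure.restrict_le_self (s := Ωᶜ)))
    refine eLpNorm_congr_norm_ae ?_
    filter_upwards [ae_restrict_mem hΩ.compl] with x hx
    rw [(hφ' k).gradient_eq_zero fun h => hx (hU h)]
    simp
  have h0 : eLpNorm g 2 (volume.restrict Ωᶜ) = 0 :=
    le_antisymm (ge_of_tendsto' h2 hle) zero_le
  rw [eLpNorm_eq_zero_iff hg.1.restrict (by simp)] at h0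
  exact (ae_restrict_iff' hΩ.compl).1 h0

/-- Turns the Dirichlet form over `Ω` into the inner product of `L²` on the whole space. -/
theorem MemH10.integral_inner_eq {U Ω : Set (EuclideanSpace ℝ (Fin d))} (hΩ : MeasurableSet Ω)
    (hU : U ⊆ Ω) {u : EuclideanSpace ℝ (Fin d) → ℝ}
    {g : EuclideanSpace ℝ (Fin d) → EuclideanSpace ℝ (Fin d)} (h : MemH10 U u g)
    (ψ : EuclideanSpace ℝ (Fin d) → EuclideanSpace ℝ (Fin d)) :
    ∫ x in Ω, inner ℝ (g x) (ψ x) = ∫ x, inner ℝ (g x) (ψ x) := by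
  refine setIntegral_eq_integral_of_ae_compl_eq_zero ?_
  filter_upwards [h.ae_eq_zero_of_notMem hΩ hU] with x hx hx'
  simp [hx hx']

/-- An inequality between the value of a continuous linear functional (or a seminorm) and the norm
of the gradient extends from test functions to `H₀¹`. -/
theorem le_of_forall_test {U : Set (EuclideanSpace ℝ (Fin d))} {N : PairSpace d → ℝ}
    (hN : Continuous N) {K : ℝ}
    (h : ∀ φ (hφ : IsTest U φ),
      N (WithLp.toLp 2 (hφ.memLp.toLp φ, hφ.memLp_gradient.toLp (gradient φ))) ≤
        K * (eLpNorm (gradient φ) 2 volume).toReal)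
    {p : PairSpace d} (hp : p ∈ (testPairs U).topologicalClosure) : N p ≤ K * ‖p.snd‖ := by
  have hs : Continuous fun p : PairSpace d => p.snd :=
    continuous_snd.comp (WithLp.prod_continuous_ofLp 2 _ _)
  refine closure_minimal (s := (testPairs U : Set (PairSpace d)))
    (t := {p | N p ≤ K * ‖p.snd‖}) ?_ (isClosed_le hN (by fun_prop)) hp
  rintro q ⟨φ, hφ, h1, h2⟩
  have hq : q = WithLp.toLp 2 (hφ.memLp.toLp φ, hφ.memLp_gradient.toLp (gradient φ)) := by
    refine (WithLp.ofLp_injective 2) (Prod.ext (Lp.ext ?_) (Lp.ext ?_))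
    · exact h1.trans hφ.memLp.coeFn_toLp.symm
    · exact h2.trans hφ.memLp_gradient.coeFn_toLp.symm
  change N q ≤ K * ‖q.snd‖
  rw [hq]
  refine (h φ hφ).trans_eq ?_
  rw [← Lp.norm_toLp (gradient φ) hφ.memLp_gradient]
  rfl

/-- A Poincaré inequality gives the existence of the weak solution, and a bound of the mean of test
functions by their energy gives a bound of the compliance. -/
theorem compliance_le {S Ω : Set (EuclideanSpace ℝ (Fin d))} (hΩ : MeasurableSet Ω)
    (hΩ' : volume Ω ≠ ⊤)
    (hP : ∀ φ, IsTest (Ω \ S) φ → eLpNorm φ 2 volume ≤ eLpNorm (gradient φ) 2 volume)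
    {K : ℝ}
    (hK : ∀ φ, IsTest (Ω \ S) φ →
      |∫ x in Ω, φ x| ≤ K * (eLpNorm (gradient φ) 2 volume).toReal) :
    compliance S (fun _ => 1) Ω ≤ ((K ^ 2 : ℝ) : EReal) := by
  set V : Submodule ℝ (PairSpace d) := (testPairs (Ω \ S)).topologicalClosure with hV
  have : CompleteSpace V := (Submodule.isClosed_topologicalClosure _).completeSpace_coe
  set one : Lp ℝ 2 (volume : Measure (EuclideanSpace ℝ (Fin d))) :=
    indicatorConstLp 2 hΩ hΩ' (1 : ℝ) with hone
  have hs : Continuous fun p : PairSpace d => p.snd :=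
    continuous_snd.comp (WithLp.prod_continuous_ofLp 2 _ _)
  have hf : Continuous fun p : PairSpace d => p.fst :=
    continuous_fst.comp (WithLp.prod_continuous_ofLp 2 _ _)
  have hmean : ∀ f : Lp ℝ 2 (volume : Measure (EuclideanSpace ℝ (Fin d))),
      inner ℝ one f = ∫ x in Ω, f x := fun f => L2.inner_indicatorConstLp_one hΩ hΩ' f
  have hPV : ∀ p ∈ V, ‖p.fst‖ ≤ 1 * ‖p.snd‖ := fun p hp => by
    refine le_of_forall_test (N := fun p => ‖p.fst‖) (by fun_prop) (fun φ hφ => ?_) hp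
    change ‖hφ.memLp.toLp φ‖ ≤ _
    rw [one_mul, Lp.norm_toLp]
    exact ENNReal.toReal_mono hφ.memLp_gradient.2.ne (hP φ hφ)
  have hKV : ∀ p ∈ V, |inner ℝ one p.fst| ≤ K * ‖p.snd‖ := fun p hp => by
    refine le_of_forall_test (N := fun p => |inner ℝ one p.fst|) (by fun_prop)
      (fun φ hφ => ?_) hp
    simp only [hmean]
    refine le_of_eq_of_le (congrArg _ ?_) (hK φ hφ)
    exact integral_congr_ae (ae_restrict_of_ae hφ.memLp.coeFn_toLp)
  let sndV : V →L[ℝ] Lp (EuclideanSpace ℝ (Fin d)) 2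
      (volume : Measure (EuclideanSpace ℝ (Fin d))) :=
    (WithLp.sndL 2 ℝ _ _).comp V.subtypeL
  let fstV : V →L[ℝ] Lp ℝ 2 (volume : Measure (EuclideanSpace ℝ (Fin d))) :=
    (WithLp.fstL 2 ℝ _ _).comp V.subtypeL
  let B : V →L[ℝ] V →L[ℝ] ℝ := (innerSL ℝ).bilinearComp sndV sndV
  have hB : ∀ p q : V, B p q = inner ℝ p.1.snd q.1.snd := fun p q => rfl
  have hcoer : IsCoercive B := by
    -- Poincaré gives `‖p‖² = ‖p.fst‖² + ‖p.snd‖² ≤ 2 ‖p.snd‖²`, whence the constant `1 / 2`.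
    refine ⟨1 / 2, by norm_num, fun p => ?_⟩
    rw [hB, real_inner_self_eq_norm_sq]
    have h1 := hPV p.1 p.2
    have h2 : ‖p‖ ^ 2 = ‖p.1.fst‖ ^ 2 + ‖p.1.snd‖ ^ 2 := WithLp.prod_norm_sq_eq_of_L2 p.1
    nlinarith [norm_nonneg p.1.fst]
  let ℓ : V →L[ℝ] ℝ := (innerSL ℝ one).comp fstV
  obtain ⟨w, hw⟩ : ∃ w : V, ∀ q : V, inner ℝ w.1.snd q.1.snd = inner ℝ one q.1.fst := by
    refine ⟨hcoer.continuousLinearEquivOfBilin.symm ((InnerProductSpace.toDual ℝ V).symm ℓ),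
      fun q => ?_⟩
    rw [← hB, ← hcoer.continuousLinearEquivOfBilin_apply, ContinuousLinearEquiv.apply_symm_apply,
      InnerProductSpace.toDual_symm_apply]
    rfl
  have hsol : IsWeakSolution (fun _ => 1) S Ω w.1.fst := by
    have hmem : MemH10 (Ω \ S) w.1.fst w.1.snd := memH10_of_mem_closure w.2
    refine ⟨w.1.snd, hmem, fun φ ψ hφ => ?_⟩
    obtain ⟨q, hq, h1, h2⟩ := exists_mem_closure_of_memH10 hφ
    rw [hmem.integral_inner_eq hΩ Set.sdiff_subset]
    have := hw ⟨q, hq⟩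
    rw [hmean, L2.inner_def] at this
    calc ∫ x, inner ℝ (w.1.snd x) (ψ x) = ∫ x, inner ℝ (w.1.snd x) (q.snd x) := by
          refine integral_congr_ae ?_
          filter_upwards [h2] with x hx
          rw [hx]
      _ = ∫ x in Ω, q.fst x := this
      _ = ∫ x in Ω, 1 * φ x := by
          refine integral_congr_ae (ae_restrict_of_ae ?_)
          filter_upwards [h1] with x hx
          rw [hx, one_mul]
  refine (iInf₂_le _ hsol).trans (EReal.coe_le_coe_iff.2 ?_)
  simp only [one_mul]
  rw [← hmean, ← hw w, real_inner_self_eq_norm_sq]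
  -- With `a = ‖∇w‖`, the equation tested with `w` gives `a² = ∫ w ≤ K a`; then `2a² ≤ 2Ka ≤ K² +
  -- a²`, with no division by `a`.
  have h1 := (le_abs_self _).trans (hKV w.1 w.2)
  rw [← hw w, real_inner_self_eq_norm_sq] at h1
  have h2 := norm_nonneg w.1.snd
  nlinarith [sq_nonneg (K - ‖w.1.snd‖)]

end WeakFormulation

end OptimalCompliance

namespace OptimalCompliance

/-! ### Integration along rays and the mean inequality on one cell. -/

section Cell

variable {E : Type*} [NormedAddCommGroup E] [NormedSpace ℝ E]

theorem enorm_sub_le_lintegral_fderiv {f : E → ℝ} (hf : ContDiff ℝ 1 f) (c v : E) :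
    ‖f (c + v) - f c‖ₑ ≤ ∫⁻ t in Set.Ioc (0 : ℝ) 1, ‖fderiv ℝ f (c + t • v)‖ₑ * ‖v‖ₑ := by
  have hder : ∀ t ∈ Set.uIcc (0 : ℝ) 1,
      HasDerivAt (fun t : ℝ => f (c + t • v)) (fderiv ℝ f (c + t • v) v) t := fun t _ => by
    have h1 : HasDerivAt (fun t : ℝ => c + t • v) v t := by
      simpa using ((hasDerivAt_id t).smul_const v).const_add c
    exact ((hf.differentiable (by simp)) _).hasFDerivAt.comp_hasDerivAt t h1
  have hc : Continuous fun t : ℝ => fderiv ℝ f (c + t • v) v :=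
    ((hf.continuous_fderiv (by simp)).comp (by fun_prop)).clm_apply continuous_const
  have := intervalIntegral.integral_eq_sub_of_hasDerivAt hder (hc.intervalIntegrable 0 1)
  simp only [one_smul, zero_smul, add_zero] at this
  rw [← this, intervalIntegral.integral_of_le zero_le_one]
  refine (enorm_integral_le_lintegral_enorm _).trans (lintegral_mono fun t => ?_)
  exact ContinuousLinearMap.le_opENorm _ _

variable [FiniteDimensional ℝ E] [MeasurableSpace E] [BorelSpace E]

theorem lintegral_comp_smul_addHaar (μ : Measure E) [μ.IsAddHaarMeasure] {f : E → ℝ≥0∞}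
    (hf : Measurable f) {t : ℝ} (ht : t ≠ 0) :
    ∫⁻ x, f (t • x) ∂μ = ENNReal.ofReal |(t ^ Module.finrank ℝ E)⁻¹| * ∫⁻ x, f x ∂μ := by
  rw [← lintegral_map hf (measurable_const_smul t), Measure.map_addHaar_smul μ ht,
    lintegral_smul_measure, smul_eq_mul]

theorem lintegral_Ici_inv_pow_succ {d : ℕ} (hd : 0 < d) {a : ℝ} (ha : 0 < a) :
    ∫⁻ t in Set.Ici a, ENNReal.ofReal (t ^ (d + 1))⁻¹ = ENNReal.ofReal ((a ^ d)⁻¹ / d) := by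
  have hd' : (0 : ℝ) < d := by exact_mod_cast hd
  have hlt : -((d : ℝ) + 1) < -1 := by linarith
  rw [← restrict_Ioi_eq_restrict_Ici]
  have h1 : ∀ t ∈ Set.Ioi a, (t ^ (d + 1))⁻¹ = t ^ (-((d : ℝ) + 1)) := fun t ht => by
    rw [Real.rpow_neg (ha.trans ht).le, ← Nat.cast_add_one, Real.rpow_natCast]
  rw [setLIntegral_congr_fun (g := fun t => ENNReal.ofReal (t ^ (-((d : ℝ) + 1))))
    measurableSet_Ioi fun t ht => by simp only [h1 t ht]]
  rw [← ofReal_integral_eq_lintegral_ofReal (integrableOn_Ioi_rpow_of_lt hlt ha)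
    ((ae_restrict_iff' measurableSet_Ioi).2 (ae_of_all _ fun t ht =>
      Real.rpow_nonneg (ha.trans ht).le _)), integral_Ioi_rpow_of_lt hlt ha]
  congr 1
  have : -((d : ℝ) + 1) + 1 = -d := by ring
  rw [this, Real.rpow_neg ha.le, Real.rpow_natCast]
  field_simp

/-- Integration along rays from the origin: each point `y` is seen with weight at most
`‖y‖ (ρ / ‖y‖)ᵈ / d`. -/
theorem lintegral_rays_le (μ : Measure E) [μ.IsAddHaarMeasure] (hd : 0 < Module.finrank ℝ E)
    {G : E → ℝ≥0∞} (hG : Measurable G) {ρ : ℝ} (hρ : 0 < ρ) :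
    ∫⁻ x in Metric.closedBall 0 ρ, (∫⁻ t in Set.Ioc (0 : ℝ) 1, G (t • x) * ‖x‖ₑ) ∂μ ≤
      ∫⁻ y, G y * ENNReal.ofReal
        (ρ ^ Module.finrank ℝ E / Module.finrank ℝ E * (‖y‖ ^ (Module.finrank ℝ E - 1))⁻¹) ∂μ := by
  set d := Module.finrank ℝ E with hdd
  -- The image of the closed ball under `y = t • x` at time `t`. In `H` the factor `t⁻¹` comes from
  -- `‖x‖ = ‖y‖ / t`; the Jacobian `t ^ (-d)` is kept outside.
  let A : Set (ℝ × E) := {p | ‖p.2‖ ≤ p.1 * ρ}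
  have hA : MeasurableSet A :=
    measurableSet_le (measurable_snd.norm) (measurable_fst.mul_const ρ)
  let H : ℝ → E → ℝ≥0∞ := fun t y =>
    A.indicator (fun p => G p.2 * ‖p.2‖ₑ * ENNReal.ofReal (p.1⁻¹)) (t, y)
  have hHm : Measurable (Function.uncurry H) := by
    refine Measurable.indicator ?_ hA
    exact ((hG.comp measurable_snd).mul measurable_snd.enorm).mul
      (ENNReal.measurable_ofReal.comp measurable_fst.inv)
  have hscale : ∀ t ∈ Set.Ioc (0 : ℝ) 1, ∫⁻ x in Metric.closedBall 0 ρ, G (t • x) * ‖x‖ₑ ∂μ =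
      ENNReal.ofReal |(t ^ d)⁻¹| * ∫⁻ y, H t y ∂μ := fun t ht => by
    rw [← lintegral_comp_smul_addHaar μ (f := H t) (hHm.comp measurable_prodMk_left) ht.1.ne',
      ← lintegral_indicator Metric.isClosed_closedBall.measurableSet]
    refine lintegral_congr fun x => ?_
    have hmem : (t, t • x) ∈ A ↔ x ∈ Metric.closedBall (0 : E) ρ := by
      simp only [A, Set.mem_ofPred_eq, norm_smul, Real.norm_eq_abs, abs_of_pos ht.1,
        mem_closedBall_zero_iff]
      exact mul_le_mul_iff_right₀ ht.1
    simp only [H]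
    by_cases hx : x ∈ Metric.closedBall (0 : E) ρ
    · rw [Set.indicator_of_mem hx, Set.indicator_of_mem (hmem.2 hx), mul_assoc]
      congr 1
      rw [enorm_smul, mul_comm ‖t‖ₑ, mul_assoc, Real.enorm_eq_ofReal ht.1.le,
        ← ENNReal.ofReal_mul ht.1.le, mul_inv_cancel₀ ht.1.ne', ENNReal.ofReal_one, mul_one]
    · rw [Set.indicator_of_notMem hx, Set.indicator_of_notMem (mt hmem.1 hx)]
  have hHm' : Measurable (Function.uncurry fun (t : ℝ) (y : E) =>
      ENNReal.ofReal |(t ^ d)⁻¹| * H t y) :=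
    (ENNReal.measurable_ofReal.comp
      (continuous_abs.measurable.comp (measurable_fst.pow_const d).inv)).mul hHm
  calc
    _ = ∫⁻ t in Set.Ioc (0 : ℝ) 1, ∫⁻ x in Metric.closedBall 0 ρ, G (t • x) * ‖x‖ₑ ∂μ := by
      refine lintegral_lintegral_swap (Measurable.aemeasurable ?_)
      exact (hG.comp (measurable_snd.smul measurable_fst)).mul measurable_fst.enorm
    _ = ∫⁻ t in Set.Ioc (0 : ℝ) 1, ∫⁻ y, ENNReal.ofReal |(t ^ d)⁻¹| * H t y ∂μ := by
      refine setLIntegral_congr_fun measurableSet_Ioc fun t ht => ?_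
      rw [hscale t ht, lintegral_const_mul _ (f := H t) (hHm.comp measurable_prodMk_left)]
    _ = ∫⁻ y, (∫⁻ t in Set.Ioc (0 : ℝ) 1, ENNReal.ofReal |(t ^ d)⁻¹| * H t y) ∂μ :=
      lintegral_lintegral_swap hHm'.aemeasurable
    _ ≤ _ := lintegral_mono fun y => ?_
  by_cases hy : y = 0
  · simp [hy, H, Set.indicator]
  have hy' : 0 < ‖y‖ := norm_pos_iff.2 hy
  calc
    -- A ray from the ball reaches `y` only at times `t ≥ ‖y‖ / ρ`; the constraint `t ≤ 1` is
    -- dropped.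
    _ ≤ ∫⁻ t in Set.Ici (‖y‖ / ρ), G y * ‖y‖ₑ * ENNReal.ofReal (t ^ (d + 1))⁻¹ := by
      rw [← lintegral_indicator measurableSet_Ioc, ← lintegral_indicator measurableSet_Ici]
      refine lintegral_mono fun t => ?_
      by_cases ht : t ∈ Set.Ioc (0 : ℝ) 1
      swap
      · rw [Set.indicator_of_notMem ht]; exact zero_le
      by_cases hm : (t, y) ∈ A
      swap
      · simp only [Set.indicator_of_mem ht, H, Set.indicator_of_notMem hm, mul_zero]
        exact zero_le
      have hm' : t ∈ Set.Ici (‖y‖ / ρ) := (div_le_iff₀ hρ).2 hm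
      rw [Set.indicator_of_mem ht, Set.indicator_of_mem hm']
      simp only [H, Set.indicator_of_mem hm]
      rw [mul_comm, mul_assoc]
      gcongr
      rw [abs_of_pos (by have := ht.1; positivity), ← ENNReal.ofReal_mul (by simpa using ht.1.le),
        pow_succ', mul_inv]
    _ = G y * ‖y‖ₑ * ENNReal.ofReal (((‖y‖ / ρ) ^ d)⁻¹ / d) := by
      rw [lintegral_const_mul _ (by fun_prop), lintegral_Ici_inv_pow_succ hd (by positivity)]
    _ ≤ _ := by
      rw [mul_assoc, ← ofReal_norm, ← ENNReal.ofReal_mul hy'.le]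
      refine mul_le_mul' le_rfl (ENNReal.ofReal_le_ofReal (le_of_eq ?_))
      obtain ⟨k, hk⟩ : ∃ k, d = k + 1 := ⟨d - 1, by omega⟩
      rw [hk, Nat.add_sub_cancel]
      field_simp
      rw [div_pow, div_mul_cancel₀ _ (by positivity), pow_succ']

/-- The square of the constant in the mean inequality on a cell of outer radius `ρ` around a ball of
radius `r`. -/
noncomputable def cellConst (μ : Measure E) (r ρ : ℝ) : ℝ :=
  Module.finrank ℝ E * μ.real (Metric.ball 0 1) *
    ((ρ ^ Module.finrank ℝ E / Module.finrank ℝ E) ^ 2 *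
      ∫ s in Set.Icc r ρ, (s ^ (Module.finrank ℝ E - 1))⁻¹)

/-- In polar coordinates the Jacobian `s ^ (d - 1)` cancels one of the two factors `(s ^ (d - 1))⁻¹`
of the squared weight. -/
theorem lintegral_weight_sq (μ : Measure E) [μ.IsAddHaarMeasure] (hd : 0 < Module.finrank ℝ E)
    {r : ℝ} (hr : 0 < r) (ρ : ℝ) :
    ∫⁻ y in {y : E | ‖y‖ ∈ Set.Icc r ρ}, ENNReal.ofReal
        (ρ ^ Module.finrank ℝ E / Module.finrank ℝ E *
          (‖y‖ ^ (Module.finrank ℝ E - 1))⁻¹) ^ (2 : ℝ) ∂μ = ENNReal.ofReal (cellConst μ r ρ) := by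
  have : Nontrivial E := Module.finrank_pos_iff.1 hd
  unfold cellConst
  set d := Module.finrank ℝ E with hdd
  let k : ℝ → ℝ := (Set.Icc r ρ).indicator fun s => (ρ ^ d / d * (s ^ (d - 1))⁻¹) ^ 2
  have hk0 : ∀ s, 0 ≤ k s := fun s => Set.indicator_nonneg (fun s _ => sq_nonneg _) s
  have hmeas : MeasurableSet {y : E | ‖y‖ ∈ Set.Icc r ρ} :=
    measurable_norm measurableSet_Icc
  have hprod : ∀ s ∈ Set.Ioi (0 : ℝ), s ^ (d - 1) • k s =
      (Set.Icc r ρ).indicator (fun s => (ρ ^ d / d) ^ 2 * (s ^ (d - 1))⁻¹) s := fun s hs => by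
    have hs' : s ^ (d - 1) ≠ 0 := pow_ne_zero _ (ne_of_gt hs)
    by_cases h : s ∈ Set.Icc r ρ
    · simp only [k, Set.indicator_of_mem h, smul_eq_mul]
      field_simp
    · simp [k, Set.indicator_of_notMem h]
  have hcont : IntegrableOn (fun s => (ρ ^ d / d) ^ 2 * (s ^ (d - 1))⁻¹) (Set.Icc r ρ) :=
    ContinuousOn.integrableOn_Icc (continuousOn_const.mul
      ((continuousOn_pow _).inv₀ fun s hs => pow_ne_zero _ (hr.trans_le hs.1).ne'))
  have hint : Integrable (fun y : E => k ‖y‖) μ := by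
    refine (integrable_fun_norm_addHaar μ).2 ?_
    refine (integrableOn_congr_fun hprod measurableSet_Ioi).2 ?_
    exact ((integrable_indicator_iff measurableSet_Icc).2 hcont).integrableOn
  calc
    _ = ∫⁻ y, ENNReal.ofReal (k ‖y‖) ∂μ := by
      rw [← lintegral_indicator hmeas]
      refine lintegral_congr fun y => ?_
      by_cases h : ‖y‖ ∈ Set.Icc r ρ
      · rw [Set.indicator_of_mem (show y ∈ {y : E | ‖y‖ ∈ Set.Icc r ρ} from h)]
        have hρ : 0 ≤ ρ := hr.le.trans (h.1.trans h.2)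
        simp only [k, Set.indicator_of_mem h]
        rw [ENNReal.ofReal_rpow_of_nonneg (by positivity) (by norm_num)]
        norm_num
      · rw [Set.indicator_of_notMem (show y ∉ {y : E | ‖y‖ ∈ Set.Icc r ρ} from h)]
        simp [k, Set.indicator_of_notMem h]
    _ = _ := by
      have hsub : Set.Icc r ρ ⊆ Set.Ioi 0 := fun s hs => hr.trans_le hs.1
      rw [← ofReal_integral_eq_lintegral_ofReal hint (ae_of_all _ fun y => hk0 _),
        integral_fun_norm_addHaar, setIntegral_congr_fun measurableSet_Ioi hprod,
        setIntegral_indicator measurableSet_Icc, Set.inter_eq_right.2 hsub, integral_const_mul, ← hdd, nsmul_eq_mul, smul_eq_mul, mul_assoc]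

theorem setLIntegral_enorm_le_of_starConvex_zero (μ : Measure E) [μ.IsAddHaarMeasure]
    (hd : 0 < Module.finrank ℝ E) {Q : Set E} (hQ : MeasurableSet Q) (hstar : StarConvex ℝ 0 Q)
    {r ρ : ℝ} (hr : 0 < r) (hρ : 0 < ρ) (hQρ : Q ⊆ Metric.closedBall 0 ρ)
    {f : E → ℝ} (hf : ContDiff ℝ 1 f) (hf0 : ∀ x ∈ Metric.closedBall (0 : E) r, f x = 0) :
    ∫⁻ x in Q, ‖f x‖ₑ ∂μ ≤ (∫⁻ x in Q, ‖fderiv ℝ f x‖ₑ ^ (2 : ℝ) ∂μ) ^ (1 / 2 : ℝ) *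
      ENNReal.ofReal (cellConst μ r ρ) ^ (1 / 2 : ℝ) := by
  -- This confines the weight to `‖y‖ ≥ r`, away from the origin, where its square need not be
  -- integrable.
  have hfd : ∀ y : E, ‖y‖ < r → fderiv ℝ f y = 0 := fun y hy => by
    have : f =ᶠ[𝓝 y] fun _ => 0 := by
      filter_upwards [Metric.isOpen_ball.mem_nhds (mem_ball_zero_iff.2 hy)] with z hz
      exact hf0 z (Metric.ball_subset_closedBall hz)
    rw [this.fderiv_eq]
    simp
  have hdm : Measurable fun x => ‖fderiv ℝ f x‖ₑ :=
    (hf.continuous_fderiv (by simp)).enorm.measurable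
  set G : E → ℝ≥0∞ := Q.indicator fun x => ‖fderiv ℝ f x‖ₑ with hG
  have hGm : Measurable G := hdm.indicator hQ
  set w : E → ℝ≥0∞ := fun y => ENNReal.ofReal
    (ρ ^ Module.finrank ℝ E / Module.finrank ℝ E * (‖y‖ ^ (Module.finrank ℝ E - 1))⁻¹) with hw
  have hwm : Measurable w := by fun_prop
  set R : Set E := {y : E | ‖y‖ ∈ Set.Icc r ρ} with hR
  have hRm : MeasurableSet R := measurable_norm measurableSet_Icc
  calc
    _ ≤ ∫⁻ x in Q, (∫⁻ t in Set.Ioc (0 : ℝ) 1, G (t • x) * ‖x‖ₑ) ∂μ := by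
      refine setLIntegral_mono' hQ fun x hx => ?_
      have h0 : f 0 = 0 := hf0 0 (Metric.mem_closedBall_self hr.le)
      have := enorm_sub_le_lintegral_fderiv hf 0 x
      simp only [zero_add, h0, sub_zero] at this
      refine this.trans_eq (setLIntegral_congr_fun measurableSet_Ioc fun t ht => ?_)
      simp only [hG]
      rw [Set.indicator_of_mem (hstar.smul_mem hx ht.1.le ht.2)]
    _ ≤ ∫⁻ x in Metric.closedBall 0 ρ, (∫⁻ t in Set.Ioc (0 : ℝ) 1, G (t • x) * ‖x‖ₑ) ∂μ :=
      lintegral_mono_set hQρ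
    _ ≤ ∫⁻ y, G y * w y ∂μ := lintegral_rays_le μ hd hGm hρ
    _ = ∫⁻ y, (G * R.indicator w) y ∂μ := by
      refine lintegral_congr fun y => ?_
      simp only [Pi.mul_apply]
      by_cases hy : y ∈ Q
      swap
      · simp [hG, Set.indicator_of_notMem hy]
      by_cases hyr : y ∈ R
      · rw [Set.indicator_of_mem hyr]
      · have : ‖y‖ < r := by
          by_contra! h
          exact hyr ⟨h, mem_closedBall_zero_iff.1 (hQρ hy)⟩
        have h0 : ‖fderiv ℝ f y‖ₑ = 0 := by 
          rw [hfd y this, ← ofReal_norm, norm_zero, ENNReal.ofReal_zero]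
        simp only [hG, Set.indicator_of_mem hy, h0, zero_mul]
    _ ≤ _ := ENNReal.lintegral_mul_le_Lp_mul_Lq μ Real.HolderConjugate.two_two
        hGm.aemeasurable (hwm.indicator hRm).aemeasurable
    _ = _ := by
      rw [← lintegral_weight_sq μ hd hr ρ, ← lintegral_indicator hQ, ← lintegral_indicator hRm]
      congr 3
      · ext y
        by_cases hy : y ∈ Q <;> simp [hG, hy]
      · ext y
        by_cases hy : y ∈ R <;> simp [hw, hy]

/-- A function vanishing on a ball has on a cell, star-shaped about the centre of the ball, a mean
controlled by its energy. -/
theorem setLIntegral_enorm_le_of_starConvex (μ : Measure E) [μ.IsAddHaarMeasure]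
    (hd : 0 < Module.finrank ℝ E) {Q : Set E} (hQ : MeasurableSet Q) {c : E}
    (hstar : StarConvex ℝ c Q)
    {r ρ : ℝ} (hr : 0 < r) (hρ : 0 < ρ) (hQρ : Q ⊆ Metric.closedBall c ρ)
    {f : E → ℝ} (hf : ContDiff ℝ 1 f) (hf0 : ∀ x ∈ Metric.closedBall c r, f x = 0) :
    ∫⁻ x in Q, ‖f x‖ₑ ∂μ ≤ (∫⁻ x in Q, ‖fderiv ℝ f x‖ₑ ^ (2 : ℝ) ∂μ) ^ (1 / 2 : ℝ) *
      ENNReal.ofReal (cellConst μ r ρ) ^ (1 / 2 : ℝ) := by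
  have hmp : MeasurePreserving (fun x : E => x + c) μ μ := measurePreserving_add_right μ c
  have hme : MeasurableEmbedding fun x : E => x + c := measurableEmbedding_addRight c
  have h := setLIntegral_enorm_le_of_starConvex_zero μ hd (Q := (fun x : E => x + c) ⁻¹' Q)
    (hmp.measurable hQ) (fun y hy a b ha hb hab => ?_) hr hρ (fun x hx => ?_)
    (f := fun x => f (x + c)) (hf.comp (contDiff_id.add contDiff_const)) (fun x hx => hf0 _ ?_)
  · simp only [fderiv_comp_add_right] at h
    rwa [hmp.setLIntegral_comp_preimage_emb hme (fun x => ‖f x‖ₑ),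
      hmp.setLIntegral_comp_preimage_emb hme (fun x => ‖fderiv ℝ f x‖ₑ ^ (2 : ℝ))] at h
  · have := hstar hy ha hb hab
    change a • (0 : E) + b • y + c ∈ Q
    convert this using 1
    rw [smul_zero, zero_add, smul_add, add_left_comm, ← add_smul, hab, one_smul]
  · simpa [dist_eq_norm] using hQρ hx
  · simpa [dist_eq_norm] using hx

end Cell

end OptimalCompliance

namespace OptimalCompliance

/-! ### Poincaré by translation, and summation over cells. -/

section Inequalities

theorem rpow_lintegral_Ioc_le {h : ℝ → ℝ≥0∞} (hh : Measurable h) :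
    (∫⁻ t in Set.Ioc (0 : ℝ) 1, h t) ^ (2 : ℝ) ≤ ∫⁻ t in Set.Ioc (0 : ℝ) 1, h t ^ (2 : ℝ) := by
  have := ENNReal.lintegral_mul_le_Lp_mul_Lq (volume.restrict (Set.Ioc (0 : ℝ) 1))
    Real.HolderConjugate.two_two hh.aemeasurable (g := fun _ => 1) aemeasurable_const
  simp only [Pi.mul_apply, mul_one, ENNReal.one_rpow, lintegral_const, MeasurableSet.univ,
    Measure.restrict_apply, Set.univ_inter, Real.volume_Ioc, sub_zero, ENNReal.ofReal_one] at this
  refine (ENNReal.rpow_le_rpow this (by norm_num)).trans_eq ?_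
  rw [← ENNReal.rpow_mul]
  norm_num

/-- The Poincaré inequality for functions whose support is moved off itself by a unit vector. -/
theorem lintegral_sq_le_of_translate {E : Type*} [NormedAddCommGroup E] [NormedSpace ℝ E]
    [FiniteDimensional ℝ E] [MeasurableSpace E] [BorelSpace E] (μ : Measure E)
    [μ.IsAddHaarMeasure] {f : E → ℝ} (hf : ContDiff ℝ 1 f) {e : E} (he : ‖e‖ = 1)
    (h : ∀ x, f x = 0 ∨ f (x + e) = 0) :
    ∫⁻ x, ‖f x‖ₑ ^ (2 : ℝ) ∂μ ≤ ∫⁻ x, ‖fderiv ℝ f x‖ₑ ^ (2 : ℝ) ∂μ := by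
  have he' : ‖e‖ₑ = 1 := by rw [← ofReal_norm, he, ENNReal.ofReal_one]
  have hdm : Measurable fun x => ‖fderiv ℝ f x‖ₑ :=
    (hf.continuous_fderiv (by simp)).enorm.measurable
  have hsh : Measurable fun p : E × ℝ => ‖fderiv ℝ f (p.1 + p.2 • e)‖ₑ :=
    hdm.comp (by fun_prop)
  calc
    _ ≤ ∫⁻ x, (∫⁻ t in Set.Ioc (0 : ℝ) 1, ‖fderiv ℝ f (x + t • e)‖ₑ ^ (2 : ℝ)) ∂μ := by
      refine lintegral_mono fun x => ?_
      rcases h x with hx | hx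
      · simp [hx]
      · have h1 := enorm_sub_le_lintegral_fderiv hf x e
        simp only [hx, zero_sub, enorm_neg, he', mul_one] at h1
        exact (ENNReal.rpow_le_rpow h1 (by norm_num)).trans
          (rpow_lintegral_Ioc_le (h := fun t => ‖fderiv ℝ f (x + t • e)‖ₑ)
            (hdm.comp (by fun_prop : Measurable fun t : ℝ => x + t • e)))
    _ = ∫⁻ t in Set.Ioc (0 : ℝ) 1, (∫⁻ x, ‖fderiv ℝ f (x + t • e)‖ₑ ^ (2 : ℝ) ∂μ) :=
      lintegral_lintegral_swap (hsh.pow_const _).aemeasurable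
    _ = ∫⁻ t in Set.Ioc (0 : ℝ) 1, (∫⁻ x, ‖fderiv ℝ f x‖ₑ ^ (2 : ℝ) ∂μ) := by
      refine lintegral_congr fun t => ?_
      exact lintegral_add_right_eq_self (fun x => ‖fderiv ℝ f x‖ₑ ^ (2 : ℝ)) (t • e)
    _ = _ := by simp

/-- Summation over disjoint cells of an inequality between the mean and the energy. -/
theorem setLIntegral_le_of_cells {E ι : Type*} [Fintype ι] [MeasurableSpace E] (μ : Measure E)
    {Q : ι → Set E} (hQ : ∀ i, MeasurableSet (Q i)) (hdisj : Pairwise (Function.onFun Disjoint Q))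
    {Ω : Set E} (hΩ : Ω ⊆ ⋃ i, Q i) {u v : E → ℝ≥0∞} {κ : ℝ≥0∞}
    (h : ∀ i, ∫⁻ x in Q i, u x ∂μ ≤ (∫⁻ x in Q i, v x ^ (2 : ℝ) ∂μ) ^ (1 / 2 : ℝ) *
      κ ^ (1 / 2 : ℝ)) :
    ∫⁻ x in Ω, u x ∂μ ≤ (∫⁻ x, v x ^ (2 : ℝ) ∂μ) ^ (1 / 2 : ℝ) *
      (Fintype.card ι * κ) ^ (1 / 2 : ℝ) := by
  have hsq : ∀ a : ℝ≥0∞, (a ^ (1 / 2 : ℝ)) ^ (2 : ℝ) = a := fun a => by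
    rw [← ENNReal.rpow_mul]; norm_num
  calc
    _ ≤ ∫⁻ x in ⋃ i, Q i, u x ∂μ := lintegral_mono_set hΩ
    _ = ∑ i, ∫⁻ x in Q i, u x ∂μ := by
      rw [lintegral_iUnion hQ hdisj, tsum_fintype]
    _ ≤ ∑ i, (∫⁻ x in Q i, v x ^ (2 : ℝ) ∂μ) ^ (1 / 2 : ℝ) * κ ^ (1 / 2 : ℝ) :=
      Finset.sum_le_sum fun i _ => h i
    _ ≤ (∑ i, ∫⁻ x in Q i, v x ^ (2 : ℝ) ∂μ) ^ (1 / 2 : ℝ) *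
        (Fintype.card ι * κ) ^ (1 / 2 : ℝ) := by
      refine (ENNReal.inner_le_Lp_mul_Lq _ _ _ Real.HolderConjugate.two_two).trans_eq ?_
      simp only [hsq, Finset.sum_const, Finset.card_univ, nsmul_eq_mul]
    _ ≤ _ := by
      rw [← tsum_fintype (L := .unconditional ι), ← lintegral_iUnion hQ hdisj]
      gcongr
      exact Measure.restrict_le_self

theorem eLpNorm_two_eq {E F : Type*} [MeasurableSpace E] [NormedAddCommGroup F] (f : E → F)
    (μ : Measure E) : eLpNorm f 2 μ = (∫⁻ x, ‖f x‖ₑ ^ (2 : ℝ) ∂μ) ^ (1 / 2 : ℝ) := by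
  rw [eLpNorm_eq_lintegral_rpow_enorm_toReal (by simp) (by simp)]
  simp

end Inequalities

/-! ### The regular grid of cells and the resulting competitor. -/

section Grid

variable {d : ℕ}

/-- The half-open cell of side `1 / m` with lower corner `k / m`. -/
def gridCell (m : ℕ) (k : Fin d → Fin m) : Set (EuclideanSpace ℝ (Fin d)) :=
  {x | ∀ i, x i ∈ Set.Ico (((k i : ℕ) : ℝ) / m) ((((k i : ℕ) : ℝ) + 1) / m)}

/-- The centre of a cell. -/
noncomputable def gridCentre (m : ℕ) (k : Fin d → Fin m) : EuclideanSpace ℝ (Fin d) :=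
  WithLp.toLp 2 fun i => (((k i : ℕ) : ℝ) + 1 / 2) / m

theorem measurableSet_gridCell (m : ℕ) (k : Fin d → Fin m) : MeasurableSet (gridCell m k) := by
  have : gridCell m k = ⋂ i, (fun x : EuclideanSpace ℝ (Fin d) => x i) ⁻¹'
      Set.Ico (((k i : ℕ) : ℝ) / m) ((((k i : ℕ) : ℝ) + 1) / m) := by
    ext x; simp [gridCell]
  rw [this]
  exact MeasurableSet.iInter fun i =>
    (by fun_prop : Measurable fun x : EuclideanSpace ℝ (Fin d) => x i) measurableSet_Ico

theorem measurableSet_unitCube : MeasurableSet (unitCube d) := by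
  have : unitCube d = ⋂ i, (fun x : EuclideanSpace ℝ (Fin d) => x i) ⁻¹' Set.Ioo 0 1 := by
    ext x; simp [unitCube]
  rw [this]
  exact MeasurableSet.iInter fun i =>
    (by fun_prop : Measurable fun x : EuclideanSpace ℝ (Fin d) => x i) measurableSet_Ioo

theorem gridCell_starConvex {m : ℕ} (hm : 0 < m) (k : Fin d → Fin m) :
    StarConvex ℝ (gridCentre m k) (gridCell m k) := by
  have hm' : (0 : ℝ) < m := by exact_mod_cast hm
  intro y hy a b ha hb hab i
  have hc : (gridCentre m k) i ∈
      Set.Ico (((k i : ℕ) : ℝ) / m) ((((k i : ℕ) : ℝ) + 1) / m) := by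
    constructor
    · change _ ≤ (((k i : ℕ) : ℝ) + 1 / 2) / m
      gcongr; linarith
    · change (((k i : ℕ) : ℝ) + 1 / 2) / m < _
      gcongr; norm_num
  exact convex_Ico _ _ hc (hy i) ha hb hab

theorem gridCell_subset_closedBall {m : ℕ} (hm : 0 < m) (k : Fin d → Fin m) :
    gridCell m k ⊆ Metric.closedBall (gridCentre m k) (√d / 2 / m) := by
  have hm' : (0 : ℝ) < m := by exact_mod_cast hm
  intro x hx
  rw [Metric.mem_closedBall, EuclideanSpace.dist_eq]
  refine Real.sqrt_le_iff.2 ⟨by positivity, ?_⟩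
  calc
    _ ≤ ∑ i : Fin d, (1 / 2 / (m : ℝ)) ^ 2 := by
      refine Finset.sum_le_sum fun i _ => ?_
      gcongr
      obtain ⟨h1, h2⟩ := hx i
      rw [div_le_iff₀ hm'] at h1
      rw [lt_div_iff₀ hm'] at h2
      have h3 : |(x i - (gridCentre m k) i) * m| ≤ 1 / 2 := by
        change |(x i - (((k i : ℕ) : ℝ) + 1 / 2) / m) * m| ≤ 1 / 2
        rw [sub_mul, div_mul_cancel₀ _ hm'.ne', abs_le]
        constructor <;> linarith
      rwa [abs_mul, abs_of_pos hm', ← le_div_iff₀ hm'] at h3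
    _ = (√d / 2 / m) ^ 2 := by
      rw [div_pow (√(d : ℝ) / 2), div_pow √(d : ℝ), Real.sq_sqrt (Nat.cast_nonneg d)]
      simp only [Finset.sum_const, Finset.card_univ, Fintype.card_fin, nsmul_eq_mul]
      ring

theorem pairwise_disjoint_gridCell {m : ℕ} (hm : 0 < m) :
    Pairwise (Function.onFun Disjoint (gridCell (d := d) m)) := by
  have hm' : (0 : ℝ) < m := by exact_mod_cast hm
  intro k l hkl
  refine Set.disjoint_left.2 fun x hx hy => hkl (funext fun i => Fin.ext ?_)
  obtain ⟨h1, h2⟩ := hx i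
  obtain ⟨h3, h4⟩ := hy i
  rw [div_le_iff₀ hm'] at h1 h3
  rw [lt_div_iff₀ hm'] at h2 h4
  have h5 : (k i : ℕ) < (l i : ℕ) + 1 := by exact_mod_cast h1.trans_lt h4
  have h6 : (l i : ℕ) < (k i : ℕ) + 1 := by exact_mod_cast h3.trans_lt h2
  omega

theorem unitCube_subset_iUnion_gridCell {m : ℕ} (hm : 0 < m) :
    unitCube d ⊆ ⋃ k : Fin d → Fin m, gridCell m k := by
  have hm' : (0 : ℝ) < m := by exact_mod_cast hm
  intro x hx
  have h0 : ∀ i, 0 ≤ x i * m := fun i => mul_nonneg (hx i).1.le hm'.le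
  have h1 : ∀ i, ⌊x i * m⌋₊ < m := fun i => by
    rw [Nat.floor_lt (h0 i)]
    nlinarith [(hx i).2]
  refine Set.mem_iUnion.2 ⟨fun i => ⟨⌊x i * m⌋₊, h1 i⟩, fun i => ⟨?_, ?_⟩⟩
  · rw [div_le_iff₀ hm']
    exact Nat.floor_le (h0 i)
  · rw [lt_div_iff₀ hm']
    exact Nat.lt_floor_add_one _

theorem gridCentre_mem_unitCube {m : ℕ} (k : Fin d → Fin m) : gridCentre m k ∈ unitCube d := by
  intro i
  have hk : ((k i : ℕ) : ℝ) + 1 ≤ m := by exact_mod_cast (k i).2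
  have hk0 : (0 : ℝ) ≤ ((k i : ℕ) : ℝ) := Nat.cast_nonneg _
  have hm' : (0 : ℝ) < m := by linarith
  change (((k i : ℕ) : ℝ) + 1 / 2) / m ∈ Set.Ioo (0 : ℝ) 1
  constructor
  · positivity
  · rw [div_lt_one hm']; linarith

theorem volume_unitCube_ne_top : volume (unitCube d) ≠ ⊤ := by
  refine ((Metric.isBounded_closedBall (x := gridCentre (d := d) 1 0) (r := √d / 2 / (1 : ℕ))).subset
    fun x hx => ?_).measure_lt_top.ne
  obtain ⟨k, hk⟩ := Set.mem_iUnion.1 (unitCube_subset_iUnion_gridCell one_pos hx)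
  rw [Subsingleton.elim 0 k]
  exact gridCell_subset_closedBall one_pos k hk

/-- A unit translation along a coordinate axis carries the open unit cube off itself, so Poincaré
holds with constant `1`, whatever `S` is. -/
theorem eLpNorm_le_gradient (hd : 0 < d) {S : Set (EuclideanSpace ℝ (Fin d))}
    {φ : EuclideanSpace ℝ (Fin d) → ℝ} (hφ : IsTest (unitCube d \ S) φ) :
    eLpNorm φ 2 volume ≤ eLpNorm (gradient φ) 2 volume := by
  rw [eLpNorm_two_eq, eLpNorm_two_eq]
  simp only [enorm_gradient]
  gcongr 1
  refine lintegral_sq_le_of_translate volume hφ.contDiff_one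
    (e := EuclideanSpace.single ⟨0, hd⟩ 1) (by simp) fun x => ?_
  by_cases hx : x ∈ unitCube d
  · refine Or.inr (hφ.eq_zero fun h => ?_)
    have h1 := (hx ⟨0, hd⟩).1
    have h2 := (h.1 ⟨0, hd⟩).2
    simp at h2
    linarith
  · exact Or.inl (hφ.eq_zero fun h => hx h.1)

theorem cellConst_nonneg {r : ℝ} (hr : 0 < r) (ρ : ℝ) :
    0 ≤ cellConst (volume : Measure (EuclideanSpace ℝ (Fin d))) r ρ := by
  refine mul_nonneg (by positivity) (mul_nonneg (by positivity) ?_)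
  exact setIntegral_nonneg measurableSet_Icc fun s hs =>
    inv_nonneg.2 (pow_nonneg (hr.le.trans hs.1) _)

theorem radius_pow {m : ℕ} (hd : 0 < d) (α : ℝ) : radius d α (m ^ d) = α / m := by
  have hd' : (d : ℝ) ≠ 0 := by exact_mod_cast hd.ne'
  rw [radius, Nat.cast_pow, ← Real.rpow_natCast (m : ℝ) d, ← Real.rpow_mul (Nat.cast_nonneg m),
    mul_div_cancel₀ _ hd', Real.rpow_neg_one, div_eq_mul_inv]

/-- Balls at the centres of the cells of a regular grid. -/
theorem exists_admissible_compliance_le (hd : 0 < d) {α : ℝ} (hα : 0 < α) {m : ℕ} (hm : 0 < m) :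
    ∃ S ∈ admissible α (m ^ d) (unitCube d), compliance S (fun _ => 1) (unitCube d) ≤
      (((m : ℝ) ^ d * cellConst (volume : Measure (EuclideanSpace ℝ (Fin d)))
        (α / m) (√d / 2 / m) : ℝ) : EReal) := by
  have hm' : (0 : ℝ) < m := by exact_mod_cast hm
  have hr : 0 < α / m := by positivity
  have hρ : 0 < √d / 2 / m := by positivity
  set κ := cellConst (volume : Measure (EuclideanSpace ℝ (Fin d))) (α / m) (√d / 2 / m) with hκ
  have hκ0 : 0 ≤ κ := cellConst_nonneg hr _
  have hcard : Fintype.card (Fin d → Fin m) = m ^ d := by simp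
  let e : Fin (m ^ d) ≃ (Fin d → Fin m) := (Fintype.equivFinOfCardEq hcard).symm
  refine ⟨_, ⟨fun i => gridCentre m (e i), fun i => ?_, rfl⟩, ?_⟩
  · rw [radius_pow hd]
    exact Metric.self_subset_thickening hr _ (gridCentre_mem_unitCube _)
  rw [radius_pow hd]
  set S := closure (unitCube d) ∩ ⋃ i, Metric.closedBall (gridCentre m (e i)) (α / m) with hS
  have hK0 : 0 ≤ (m : ℝ) ^ d * κ := by positivity
  have hmean : ∀ φ, IsTest (unitCube d \ S) φ →
      |∫ x in unitCube d, φ x| ≤ √((m : ℝ) ^ d * κ) * (eLpNorm (gradient φ) 2 volume).toReal := by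
    intro φ hφ
    have hcell : ∀ k, ∫⁻ x in gridCell m k, ‖φ x‖ₑ ≤
        (∫⁻ x in gridCell m k, ‖fderiv ℝ φ x‖ₑ ^ (2 : ℝ)) ^ (1 / 2 : ℝ) *
          ENNReal.ofReal κ ^ (1 / 2 : ℝ) := fun k => by
      refine setLIntegral_enorm_le_of_starConvex volume (by simpa using hd)
        (measurableSet_gridCell m k) (gridCell_starConvex hm k) hr hρ
        (gridCell_subset_closedBall hm k) hφ.contDiff_one fun x hx => hφ.eq_zero fun hxU => ?_
      refine hxU.2 ⟨subset_closure hxU.1, Set.mem_iUnion.2 ⟨e.symm k, ?_⟩⟩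
      rwa [e.apply_symm_apply]
    have hsum := setLIntegral_le_of_cells volume (measurableSet_gridCell m)
      (pairwise_disjoint_gridCell hm) (unitCube_subset_iUnion_gridCell hm) hcell
    have hgrad : (∫⁻ x, ‖fderiv ℝ φ x‖ₑ ^ (2 : ℝ)) ^ (1 / 2 : ℝ) =
        eLpNorm (gradient φ) 2 volume := by
      rw [eLpNorm_two_eq]
      simp only [enorm_gradient]
    have hconst : ((Fintype.card (Fin d → Fin m) : ℝ≥0∞) * ENNReal.ofReal κ) ^ (1 / 2 : ℝ) =
        ENNReal.ofReal √((m : ℝ) ^ d * κ) := by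
      rw [hcard, Real.sqrt_eq_rpow, ← ENNReal.ofReal_rpow_of_nonneg hK0 (by norm_num),
        ENNReal.ofReal_mul (by positivity), ENNReal.ofReal_pow hm'.le, ENNReal.ofReal_natCast,
        Nat.cast_pow]
    rw [hgrad, hconst, mul_comm] at hsum
    have hfin : ENNReal.ofReal √((m : ℝ) ^ d * κ) * eLpNorm (gradient φ) 2 volume ≠ ⊤ :=
      ENNReal.mul_ne_top ENNReal.ofReal_ne_top hφ.memLp_gradient.2.ne
    have := ENNReal.toReal_mono hfin ((enorm_integral_le_lintegral_enorm _).trans hsum)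
    rwa [ENNReal.toReal_mul, ENNReal.toReal_ofReal (Real.sqrt_nonneg _), toReal_enorm,
      Real.norm_eq_abs] at this
  have := compliance_le measurableSet_unitCube volume_unitCube_ne_top
    (fun φ hφ => eLpNorm_le_gradient hd hφ) hmean
  rwa [Real.sq_sqrt hK0] at this

theorem admissible_nonempty {α : ℝ} (hα : 0 < α) {n : ℕ} (hn : 0 < n) :
    (admissible α n (unitCube d)).Nonempty := by
  have hr : 0 < radius d α n := mul_pos hα (Real.rpow_pos_of_pos (by exact_mod_cast hn) _)
  exact ⟨_, fun _ => gridCentre 1 0,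
    fun _ => Metric.self_subset_thickening hr _ (gridCentre_mem_unitCube _), rfl⟩

/-- A liminf is bounded by any bound that holds frequently, here along the perfect powers `n = m ^
d`; elsewhere any admissible set will do. -/
theorem theta_le (hd : 0 < d) {α : ℝ} (hα : 0 < α) {b : ℝ}
    (hb : ∀ m : ℕ, 0 < m → (m : ℝ) ^ 2 * ((m : ℝ) ^ d *
      cellConst (volume : Measure (EuclideanSpace ℝ (Fin d))) (α / m) (√d / 2 / m)) ≤ b) :
    theta d α ≤ (b : EReal) := by
  have hd' : (d : ℝ) ≠ 0 := by exact_mod_cast hd.ne'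
  have key : ∀ n : ℕ, ∃ S : Set (EuclideanSpace ℝ (Fin d)),
      (0 < n → S ∈ admissible α n (unitCube d)) ∧ ((∃ m : ℕ, 0 < m ∧ n = m ^ d) →
        (((n : ℝ) ^ (2 / (d : ℝ)) : ℝ) : EReal) * compliance S (fun _ => 1) (unitCube d) ≤ b) := by
    intro n
    by_cases hn : ∃ m : ℕ, 0 < m ∧ n = m ^ d
    · obtain ⟨m, hm, rfl⟩ := hn
      obtain ⟨S, hS, hle⟩ := exists_admissible_compliance_le hd hα hm
      refine ⟨S, fun _ => hS, fun _ => ?_⟩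
      have hpow : ((m ^ d : ℕ) : ℝ) ^ (2 / (d : ℝ)) = (m : ℝ) ^ 2 := by
        rw [Nat.cast_pow, ← Real.rpow_natCast (m : ℝ) d, ← Real.rpow_mul (Nat.cast_nonneg m),
          mul_div_cancel₀ _ hd', Real.rpow_two]
      rw [hpow]
      refine (mul_le_mul_of_nonneg_left hle (EReal.coe_nonneg.2 (by positivity))).trans ?_
      rw [← EReal.coe_mul]
      exact EReal.coe_le_coe_iff.2 (hb m hm)
    · by_cases h0 : 0 < n
      · obtain ⟨S, hS⟩ := admissible_nonempty hα h0
        exact ⟨S, fun _ => hS, fun h => absurd h hn⟩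
      -- The index `n = 0` carries no admissibility condition.
      · exact ⟨∅, fun h => absurd h h0, fun h => absurd h hn⟩
  choose S hS hle using key
  refine le_trans (sInf_le ⟨S, fun n => hS n, rfl⟩) (liminf_le_of_frequently_le' ?_)
  refine frequently_atTop.2 fun N => ⟨(N + 1) ^ d, ?_, hle _ ⟨N + 1, N.succ_pos, rfl⟩⟩
  exact (Nat.le_succ N).trans (Nat.le_self_pow hd.ne' _)

end Grid

/-! ### The radial integral in the two dimension ranges. -/

section Constants

/-- The exponent is at least two, so the integral may be extended to infinity; the resulting factor
`1 / (k + 1)` is discarded. -/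
theorem setIntegral_Icc_inv_pow_le (k : ℕ) {r : ℝ} (hr : 0 < r) (ρ : ℝ) :
    ∫ s in Set.Icc r ρ, (s ^ (k + 2))⁻¹ ≤ (r ^ (k + 1))⁻¹ := by
  have hnn : 0 ≤ᵐ[volume.restrict (Set.Icc r ρ)] fun s : ℝ => (s ^ (k + 2))⁻¹ :=
    (ae_restrict_iff' measurableSet_Icc).2 (ae_of_all _ fun s hs =>
      inv_nonneg.2 (pow_nonneg (hr.le.trans hs.1) _))
  rw [integral_eq_lintegral_of_nonneg_ae hnn
    (by fun_prop : Measurable fun s : ℝ => (s ^ (k + 2))⁻¹).aestronglyMeasurable]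
  refine ENNReal.toReal_le_of_le_ofReal (by positivity) ?_
  refine (lintegral_mono_set Set.Icc_subset_Ici_self).trans ?_
  rw [lintegral_Ici_inv_pow_succ k.succ_pos hr]
  refine ENNReal.ofReal_le_ofReal (div_le_self (by positivity) ?_)
  exact_mod_cast k.succ_pos

/-- The value zero occurs for `ρ ≤ r`, when the ball covers the whole cell. -/
theorem setIntegral_Icc_inv {r ρ : ℝ} (hr : 0 < r) (hρ : 0 < ρ) :
    ∫ s in Set.Icc r ρ, s⁻¹ = max 0 (Real.log (ρ / r)) := by
  rcases le_total r ρ with h | h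
  · rw [integral_Icc_eq_integral_Ioc, ← intervalIntegral.integral_of_le h,
      integral_inv_of_pos hr hρ, max_eq_right]
    exact Real.log_nonneg ((one_le_div hr).2 h)
  · rw [max_eq_left (Real.log_nonpos (by positivity) ((div_le_one hr).2 h)),
      setIntegral_measure_zero]
    rw [Real.volume_Icc, ENNReal.ofReal_eq_zero]
    linarith

end Constants

end OptimalCompliance

/-! ### Scaling and the explicit constant. -/

theorem proposition4p4 (d : ℕ) (hd : 2 ≤ d) :
    ∃ C : ℝ, ∀ α : ℝ, 0 < α →
      (3 ≤ d → OptimalCompliance.theta d α ≤ ((C * α ^ (2 - (d : ℤ)) : ℝ) : EReal)) ∧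
      (d = 2 → OptimalCompliance.theta d α ≤
        ((C * max 0 (Real.log ((Real.sqrt 2 * α)⁻¹)) : ℝ) : EReal)) := by
  -- This is the factor of `cellConst` in front of the radial integral, at scale `m = 1` with
  -- circumradius `√d / 2`.
  refine ⟨d * MeasureTheory.volume.real (Metric.ball (0 : EuclideanSpace ℝ (Fin d)) 1) *
    ((√d / 2) ^ d / d) ^ 2, fun α hα => ⟨fun h3 => ?_, fun h2 => ?_⟩⟩
  · refine OptimalCompliance.theta_le (by omega) hα fun m hm => ?_
    have hm' : (0 : ℝ) < m := by exact_mod_cast hm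
    obtain ⟨k, rfl⟩ : ∃ k, d = k + 3 := ⟨d - 3, by omega⟩
    have hint := OptimalCompliance.setIntegral_Icc_inv_pow_le k (r := α / m) (by positivity)
      (√((k + 3 : ℕ) : ℝ) / 2 / m)
    have hα' : α ^ (2 - ((k + 3 : ℕ) : ℤ)) = (α ^ (k + 1))⁻¹ := by
      rw [← zpow_natCast, ← zpow_neg]
      congr 1
    rw [OptimalCompliance.cellConst, finrank_euclideanSpace_fin, hα']
    simp only [Nat.add_succ_sub_one]
    refine (mul_le_mul_of_nonneg_left (mul_le_mul_of_nonneg_left (mul_le_mul_of_nonneg_left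
      (mul_le_mul_of_nonneg_left hint ?_) ?_) ?_) ?_).trans_eq ?_
    any_goals positivity
    generalize √((k + 3 : ℕ) : ℝ) = R
    generalize MeasureTheory.volume.real (Metric.ball (0 : EuclideanSpace ℝ (Fin (k + 3))) 1) = w
    simp only [div_pow]
    field_simp
    ring
  · subst h2
    refine OptimalCompliance.theta_le (by omega) hα fun m hm => ?_
    have hm' : (0 : ℝ) < m := by exact_mod_cast hm
    rw [OptimalCompliance.cellConst, finrank_euclideanSpace_fin]
    simp only [Nat.add_one_sub_one, pow_one]
    -- The ratio `ρ / r` does not depend on `m`; this is where the `√2` in the logarithm originates.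
    have hlog : √((2 : ℕ) : ℝ) / 2 / m / (α / m) = (√2 * α)⁻¹ := by
      have h2 : √(2 : ℝ) * √2 = 2 := Real.mul_self_sqrt (by norm_num)
      rw [Nat.cast_ofNat]
      field_simp
      linarith
    rw [OptimalCompliance.setIntegral_Icc_inv (by positivity) (by positivity), hlog]
    apply le_of_eq
    generalize √((2 : ℕ) : ℝ) = R
    simp only [div_pow]
    field_simp
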